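/- For $n \ge 2$ let $B_n$ be Artin's braid group, generated by $\sigma_1,\dots,\sigma_{n-1}$ subject to the relations $\sigma_i\sigma_j=\sigma_j\sigma_i$ for $|i-j|\ge 2$ and $\sigma_i\sigma_{i+1}\sigma_i=\sigma_{i+1}\sigma_i\sigma_{i+1}$ for $1\le i\le n-2$. A half-twist in $B_n$ is an element of the conjugacy class $\{q^{-1}\sigma_1 q : q\in B_n\}$ of $\sigma_1$. Theorem 2.11. Let $n\ge 2$, let $H_1,H_2\in B_n$ be half-twists, and suppose that $H_1^m=H_2^m$ for some integer $m\ge 1$. Then $H_1=H_2$. In contrast, roots are not unique among arbitrary braids: in $B_4$ there are elements $a\neq b$ with $a^2=b^2$. -/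

import Mathlib

/-- The defining relators of Artin's braid group on `n` strings. The generators are indexed by
`Fin (n - 1)`, so that `i : Fin (n - 1)` stands for the generator usually written `σ_{i+1}`. -/
def braidRels (n : ℕ) : Set (FreeGroup (Fin (n - 1))) :=
  {r | (∃ i j : Fin (n - 1), (i : ℕ) + 2 ≤ j ∧
          r = FreeGroup.of i * FreeGroup.of j * (FreeGroup.of j * FreeGroup.of i)⁻¹) ∨
       (∃ i j : Fin (n - 1), (i : ℕ) + 1 = j ∧
          r = FreeGroup.of i * FreeGroup.of j * FreeGroup.of i *
            (FreeGroup.of j * FreeGroup.of i * FreeGroup.of j)⁻¹)}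

/-- Artin's braid group `B_n`, given by generators and relations. -/
abbrev BraidGroup (n : ℕ) : Type := PresentedGroup (braidRels n)

/-- The standard generator of `B_n` with (zero-based) index `i`; `braidGen n 0` is `σ₁`. -/
def braidGen (n : ℕ) (i : Fin (n - 1)) : BraidGroup n := PresentedGroup.of i

/-- The set of half-twists in `B_n` (`n ≥ 2`): the conjugacy class `{q⁻¹ σ₁ q : q ∈ B_n}`. -/
def halfTwists (n : ℕ) (hn : 2 ≤ n) : Set (BraidGroup n) :=
  {β | ∃ q : BraidGroup n, β = q⁻¹ * braidGen n ⟨0, by omega⟩ * q}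


/-!
By Garside's theorem the positive braids embed into the braid group. Moreover the full twist is
central and every positive braid divides one of its powers, so every braid is positive up to a
central factor. Hence it suffices to show that a positive braid `x` with `σᵢᵐ x = x σⱼᵐ` satisfies
`σᵢ x = x σⱼ`. If `c` is the first letter of `x`, then `c` left divides `σᵢᵐ x`, and Garside's
description of the common multiples of two generators shows that `x` begins with `c` if `c` is `σᵢ`
or commutes with it, and with `c σᵢ` otherwise. This initial factor conjugates one generator into
`σᵢ`, so it can be cancelled, and the claim follows by induction on the length of `x`.

The failure of uniqueness in `B₄` comes from `c = σ₁σ₂σ₃`, whose fourth power is the full twist: the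
square of `c` and its conjugates have the same square, but not all of them induce the same
permutation.
-/

section Monoid

universe u

variable {M : Type u} {G : Type*} [Monoid M] [Group G] {z : M}

theorem conj_eq_conj_of_pow_eq {x : G} {m : ℕ} (hx : ∀ q, Commute (x ^ m) q → Commute x q)
    {q₁ q₂ : G} (h : (q₁⁻¹ * x * q₁) ^ m = (q₂⁻¹ * x * q₂) ^ m) :
    q₁⁻¹ * x * q₁ = q₂⁻¹ * x * q₂ := by
  have conj_pow' (q : G) : (q⁻¹ * x * q) ^ m = q⁻¹ * x ^ m * q := by
    simpa only [inv_inv] using conj_pow (i := m) (a := q⁻¹) (b := x)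
  have hcomm : Commute (x ^ m) (q₁ * q₂⁻¹) := by
    rw [conj_pow', conj_pow'] at h
    calc x ^ m * (q₁ * q₂⁻¹) = q₁ * (q₁⁻¹ * x ^ m * q₁) * q₂⁻¹ := by group
      _ = q₁ * q₂⁻¹ * x ^ m := by rw [h]; group
  calc q₁⁻¹ * x * q₁ = q₁⁻¹ * (x * (q₁ * q₂⁻¹)) * q₂ := by group
    _ = q₂⁻¹ * x * q₂ := by rw [(hx _ hcomm).eq]; group

/-- A central element some power of which is divisible by any given element. It plays the role of
Garside's `Δ²`: inverting it alone turns the monoid into a group. -/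
structure IsCentralCofinal (z : M) : Prop where
  commute (x : M) : Commute z x
  dvd_pow (x : M) : ∃ r : ℕ, x ∣ z ^ r

namespace IsCentralCofinal

theorem of_closure_eq_top {S : Set M} (hS : Submonoid.closure S = ⊤)
    (hcomm : ∀ x ∈ S, Commute z x) (hdvd : ∀ x ∈ S, x ∣ z) : IsCentralCofinal z := by
  have hcentral (x : M) : Commute z x := by
    have hx : x ∈ Submonoid.closure S := hS ▸ Submonoid.mem_top x
    induction hx using Submonoid.closure_induction with
    | mem x hx => exact hcomm x hx
    | one => exact Commute.one_right z
    | mul x y _ _ hx hy => exact hx.mul_right hy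
  refine ⟨hcentral, fun x ↦ ?_⟩
  have hx : x ∈ Submonoid.closure S := hS ▸ Submonoid.mem_top x
  induction hx using Submonoid.closure_induction with
  | mem x hx => exact ⟨1, by simpa only [pow_one] using hdvd x hx⟩
  | one => exact ⟨0, one_dvd _⟩
  | mul x y _ _ hx hy =>
    obtain ⟨r, a, ha⟩ := hx
    obtain ⟨s, b, hb⟩ := hy
    refine ⟨r + s, b * a, ?_⟩
    calc z ^ (r + s) = x * (a * z ^ s) := by rw [pow_add, ha, mul_assoc]
      _ = x * (z ^ s * a) := by rw [((hcentral a).pow_left s).eq]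
      _ = x * y * (b * a) := by rw [hb]; simp only [mul_assoc]

theorem exists_commute_mul_eq_pow [IsLeftCancelMul M] (hz : IsCentralCofinal z) (x : M) :
    ∃ (r : ℕ) (y : M), Commute x y ∧ x * y = z ^ r := by
  obtain ⟨r, y, hy⟩ := hz.dvd_pow x
  refine ⟨r, y, mul_left_cancel (a := x) ?_, hy.symm⟩
  rw [← mul_assoc x y x, ← hy, ((hz.commute x).pow_left r).eq]

/-- The powers of a central element form an Ore set, with the element itself as numerator. -/
abbrev oreSet (hz : IsCentralCofinal z) : OreLocalization.OreSet (Submonoid.powers z) where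
  ore_right_cancel := by
    rintro r₁ r₂ ⟨_, j, rfl⟩ h
    exact ⟨⟨_, j, rfl⟩, by simpa only [((hz.commute _).pow_left j).eq] using h⟩
  oreNum r _ := r
  oreDenom _ s := s
  ore_eq := by
    rintro r ⟨_, j, rfl⟩
    exact ((hz.commute r).pow_left j).eq

theorem exists_injective_monoidHom_group [IsLeftCancelMul M] (hz : IsCentralCofinal z) :
    ∃ (H : Type u) (_ : Group H) (f : M →* H), Function.Injective f := by
  let := hz.oreSet
  let f : M →* OreLocalization (Submonoid.powers z) M := OreLocalization.numeratorHom
  have hunit (x : M) : IsUnit (f x) := by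
    obtain ⟨r, y, hcomm, hxy⟩ := hz.exists_commute_mul_eq_pow x
    have hr : IsUnit (f (x * y)) :=
      hxy ▸ OreLocalization.numerator_isUnit ⟨z ^ r, pow_mem (Submonoid.mem_powers z) r⟩
    rw [map_mul] at hr
    exact ((hcomm.map f).isUnit_mul_iff.1 hr).1
  refine ⟨_, inferInstance, IsUnit.liftRight f hunit, fun x y hxy ↦ ?_⟩
  obtain ⟨u, v, huv, hu⟩ := OreLocalization.oreDiv_eq_iff.1 (congrArg Units.val hxy)
  simp only [OneMemClass.coe_one, mul_one] at hu
  rw [← hu] at huv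
  exact (mul_left_cancel huv).symm

variable {φ : M →* G}

theorem commute_map (hz : IsCentralCofinal z) (hφ : Subgroup.closure (Set.range φ) = ⊤) (q : G) :
    Commute (φ z) q := by
  have hle : Subgroup.closure (Set.range φ) ≤ Subgroup.centralizer {φ z} := by
    rw [Subgroup.closure_le]
    rintro _ ⟨x, rfl⟩
    exact Subgroup.mem_centralizer_singleton_iff.2 ((hz.commute x).map φ).symm.eq
  exact (Subgroup.mem_centralizer_singleton_iff.1 (hle (hφ ▸ Subgroup.mem_top q))).symm

theorem exists_mul_pow_eq_map (hz : IsCentralCofinal z)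
    (hφ : Subgroup.closure (Set.range φ) = ⊤) (q : G) :
    ∃ (r : ℕ) (p : M), q * φ z ^ r = φ p := by
  have hq : q ∈ Subgroup.closure (Set.range φ) := hφ ▸ Subgroup.mem_top q
  induction hq using Subgroup.closure_induction'' with
  | mem _ hx =>
    obtain ⟨p, rfl⟩ := hx
    exact ⟨0, p, by rw [pow_zero, mul_one]⟩
  | inv_mem _ hx =>
    obtain ⟨x, rfl⟩ := hx
    obtain ⟨r, y, hy⟩ := hz.dvd_pow x
    exact ⟨r, y, by rw [← map_pow, hy, map_mul, inv_mul_cancel_left]⟩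
  | one => exact ⟨0, 1, by rw [pow_zero, mul_one, map_one]⟩
  | mul q₁ q₂ _ _ h₁ h₂ =>
    obtain ⟨r₁, p₁, h₁⟩ := h₁
    obtain ⟨r₂, p₂, h₂⟩ := h₂
    refine ⟨r₁ + r₂, p₁ * p₂, ?_⟩
    calc q₁ * q₂ * φ z ^ (r₁ + r₂) = q₁ * (q₂ * φ z ^ r₁) * φ z ^ r₂ := by
          rw [pow_add]; simp only [mul_assoc]
      _ = q₁ * φ z ^ r₁ * (q₂ * φ z ^ r₂) := by
          rw [← ((hz.commute_map hφ q₂).pow_left r₁).eq]; simp only [mul_assoc]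
      _ = φ (p₁ * p₂) := by rw [h₁, h₂, map_mul]

theorem commute_map_of_forall_commute (hz : IsCentralCofinal z)
    (hφ : Subgroup.closure (Set.range φ) = ⊤) (hinj : Function.Injective φ) {a b : M}
    (hab : ∀ p, Commute a p → Commute b p) {q : G} (h : Commute (φ a) q) : Commute (φ b) q := by
  obtain ⟨r, p, hp⟩ := hz.exists_mul_pow_eq_map hφ q
  have hzr (x : G) : Commute x (φ z ^ r) := ((hz.commute_map hφ x).pow_left r).symm
  have hap : Commute a p := Commute.of_map hinj (hp ▸ h.mul_right (hzr _))
  have hbq : Commute (φ b) (q * φ z ^ r) := hp ▸ (hab p hap).map φ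
  simpa only [mul_inv_cancel_right] using hbq.mul_right (hzr _).inv_right

end IsCentralCofinal

end Monoid

section BraidFamily

variable {M N : Type*} [Monoid M] [Monoid N] {k : ℕ}

/-- A finite sequence in a monoid that satisfies Artin's braid relations. -/
structure IsBraidFamily (f : Fin k → M) : Prop where
  commute {i j : Fin k} (h : (i : ℕ) + 2 ≤ j) : Commute (f i) (f j)
  braid {i j : Fin k} (h : (i : ℕ) + 1 = j) : f i * f j * f i = f j * f i * f j

/-- The product `f 0 * ⋯ * f (k - 1)`. For the Artin generators its conjugation action shifts the
indices by one. -/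
def coxeterProd (f : Fin k → M) : M := Fin.partialProd f (Fin.last k)

/-- The element `Δ²`, which for the Artin generators of the braid group is the full twist of all
`k + 1` strings. -/
def fullTwist (f : Fin k → M) : M := coxeterProd f ^ (k + 1)

theorem map_coxeterProd (φ : M →* N) (f : Fin k → M) :
    φ (coxeterProd f) = coxeterProd (φ ∘ f) := by
  simp [coxeterProd, Fin.partialProd, map_list_prod, List.map_take]

theorem coxeterProd_eq_mul_tail (f : Fin (k + 1) → M) :
    coxeterProd f = f 0 * coxeterProd (Fin.tail f) := by
  rw [coxeterProd, ← Fin.succ_last, Fin.partialProd_succ', coxeterProd]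

theorem coxeterProd_eq_init_mul (f : Fin (k + 1) → M) :
    coxeterProd f = coxeterProd (Fin.init f) * f (Fin.last k) := by
  rw [coxeterProd, ← Fin.succ_last, Fin.partialProd_succ, coxeterProd, Fin.partialProd_init]

namespace IsBraidFamily

theorem map {f : Fin k → M} (hf : IsBraidFamily f) (φ : M →* N) : IsBraidFamily (φ ∘ f) where
  commute h := (hf.commute h).map φ
  braid h := by simp only [Function.comp_apply, ← map_mul, hf.braid h]

theorem partialProd_commute {f : Fin k → M} (hf : IsBraidFamily f) {r : Fin (k + 1)} {j : Fin k}
    (h : (r : ℕ) + 1 ≤ j) : Commute (Fin.partialProd f r) (f j) := by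
  induction r using Fin.induction with
  | zero => simp
  | succ r ih =>
    rw [Fin.val_succ] at h
    rw [Fin.partialProd_succ]
    exact (ih (by rw [Fin.val_castSucc]; omega)).mul_left (hf.commute (by omega))

theorem partialProd_semiconjBy {f : Fin k → M} (hf : IsBraidFamily f) {r : Fin (k + 1)}
    {i j : Fin k} (hij : (i : ℕ) + 1 = j) (hjr : (j : ℕ) < r) :
    SemiconjBy (Fin.partialProd f r) (f i) (f j) := by
  induction r using Fin.induction with
  | zero => simp at hjr
  | succ r ih =>
    rw [Fin.val_succ] at hjr
    rw [Fin.partialProd_succ]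
    obtain h | rfl : (j : ℕ) < r ∨ j = r := by omega
    · exact (ih h).mul_left (hf.commute (by omega)).symm
    · have hsplit : Fin.partialProd f j.castSucc = Fin.partialProd f i.castSucc * f i := by
        rw [← Fin.partialProd_succ]; congr 1; ext; simp [hij]
      have hcomm : Commute (Fin.partialProd f i.castSucc) (f j) :=
        hf.partialProd_commute (by simp [hij])
      rw [hsplit, SemiconjBy]
      calc _ = Fin.partialProd f i.castSucc * (f i * f j * f i) := by simp only [mul_assoc]
        _ = Fin.partialProd f i.castSucc * f j * (f i * f j) := by
          rw [hf.braid hij]; simp only [mul_assoc]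
        _ = _ := by rw [hcomm.eq]; simp only [mul_assoc]

theorem coxeterProd_pow_semiconjBy {f : Fin k → M} (hf : IsBraidFamily f) {i j : Fin k} {r : ℕ}
    (hij : (i : ℕ) + r = j) : SemiconjBy (coxeterProd f ^ r) (f i) (f j) := by
  induction r generalizing j with
  | zero => simp [Fin.ext hij]
  | succ r ih =>
    rw [pow_succ']
    exact (hf.partialProd_semiconjBy (i := ⟨i + r, by omega⟩) hij (by simp)).mul_left (ih rfl)

theorem coxeterProd_semiconjBy_init_tail {f : Fin (k + 1) → M} (hf : IsBraidFamily f) :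
    SemiconjBy (coxeterProd f) (coxeterProd (Fin.init f)) (coxeterProd (Fin.tail f)) := by
  suffices h : ∀ r, SemiconjBy (coxeterProd f) (Fin.partialProd (Fin.init f) r)
      (Fin.partialProd (Fin.tail f) r) from h _
  intro r
  induction r using Fin.induction with
  | zero => simp
  | succ r ih =>
    rw [Fin.partialProd_succ, Fin.partialProd_succ]
    exact ih.mul_right (hf.partialProd_semiconjBy (by simp) (by simp))

theorem coxeterProd_sq_semiconjBy {f : Fin (k + 1) → M} (hf : IsBraidFamily f) :
    SemiconjBy (coxeterProd f ^ 2) (f (Fin.last k)) (f 0) := by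
  have h := hf.coxeterProd_semiconjBy_init_tail.eq
  calc coxeterProd f ^ 2 * f (Fin.last k)
      = f 0 * (coxeterProd (Fin.tail f) * coxeterProd f) * f (Fin.last k) := by
        rw [sq, ← mul_assoc (f 0), ← coxeterProd_eq_mul_tail]
    _ = f 0 * (coxeterProd f * (coxeterProd (Fin.init f) * f (Fin.last k))) := by
        rw [← h]; simp only [mul_assoc]
    _ = f 0 * coxeterProd f ^ 2 := by rw [← coxeterProd_eq_init_mul, sq]

theorem commute_fullTwist {f : Fin k → M} (hf : IsBraidFamily f) (i : Fin k) :
    Commute (fullTwist f) (f i) := by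
  obtain _ | k := k
  · exact i.elim0
  have to_last : SemiconjBy (coxeterProd f ^ (k - i : ℕ)) (f i) (f (Fin.last k)) :=
    hf.coxeterProd_pow_semiconjBy (by rw [Fin.val_last]; omega)
  have from_zero : SemiconjBy (coxeterProd f ^ (i : ℕ)) (f 0) (f i) :=
    hf.coxeterProd_pow_semiconjBy (by simp)
  have h := (from_zero.mul_left hf.coxeterProd_sq_semiconjBy).mul_left to_last
  rwa [← pow_add, ← pow_add, show (i : ℕ) + 2 + (k - i) = k + 1 + 1 by omega] at h

theorem dvd_fullTwist {f : Fin k → M} (hf : IsBraidFamily f) (i : Fin k) : f i ∣ fullTwist f := by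
  obtain _ | k := k
  · exact i.elim0
  have from_zero : SemiconjBy (coxeterProd f ^ (i : ℕ)) (f 0) (f i) :=
    hf.coxeterProd_pow_semiconjBy (by simp)
  refine Dvd.intro
    (coxeterProd f ^ (i : ℕ) * (coxeterProd (Fin.tail f) * coxeterProd f ^ (k + 1 - i : ℕ)))
    (Eq.symm ?_)
  calc fullTwist f
      = coxeterProd f ^ (i : ℕ) * (coxeterProd f * coxeterProd f ^ (k + 1 - i : ℕ)) := by
        rw [← pow_succ', ← pow_add, fullTwist]; congr 1; omega
    _ = coxeterProd f ^ (i : ℕ) *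
          (f 0 * (coxeterProd (Fin.tail f) * coxeterProd f ^ (k + 1 - i : ℕ))) := by
        rw [← mul_assoc (f 0), ← coxeterProd_eq_mul_tail]
    _ = f i * (coxeterProd f ^ (i : ℕ) *
          (coxeterProd (Fin.tail f) * coxeterProd f ^ (k + 1 - i : ℕ))) := by
        rw [← mul_assoc, from_zero.eq, mul_assoc]

end IsBraidFamily

end BraidFamily

namespace ArtinMonoid

variable {ι : Type*}

/-- The braid and commutation relations between the vertices of a graph. -/
inductive Rel (G : SimpleGraph ι) : FreeMonoid ι → FreeMonoid ι → Prop
  | commute {i j : ι} (h : Gᶜ.Adj i j) : Rel G (.of i * .of j) (.of j * .of i)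
  | braid {i j : ι} (h : G.Adj i j) : Rel G (.of i * (.of j * .of i)) (.of j * (.of i * .of j))

end ArtinMonoid

/-- The Artin monoid of small type of a graph: its generators are the vertices, adjacent vertices
satisfy the braid relation and non-adjacent ones commute. Positive braids are the case of a path. -/
abbrev ArtinMonoid {ι : Type*} (G : SimpleGraph ι) : Type _ := PresentedMonoid (ArtinMonoid.Rel G)

namespace ArtinMonoid

open PresentedMonoid (mk surjective_mk mk_eq_mk_iff mk_eq_mk_of_rel)

variable {ι : Type*} {G : SimpleGraph ι} {i j : ι}

/-- The generator of the Artin monoid at a vertex. -/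
def gen (i : ι) : ArtinMonoid G := PresentedMonoid.of (Rel G) i

theorem gen_commute (h : Gᶜ.Adj i j) : Commute (gen i : ArtinMonoid G) (gen j) :=
  mk_eq_mk_of_rel (.commute h)

theorem gen_left_comm (h : Gᶜ.Adj i j) (x : ArtinMonoid G) :
    gen i * (gen j * x) = gen j * (gen i * x) :=
  (gen_commute h).left_comm x

theorem gen_braid (h : G.Adj i j) :
    (gen i * (gen j * gen i) : ArtinMonoid G) = gen j * (gen i * gen j) :=
  mk_eq_mk_of_rel (.braid h)

theorem gen_left_braid (h : G.Adj i j) (x : ArtinMonoid G) :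
    gen i * (gen j * (gen i * x)) = gen j * (gen i * (gen j * x)) := by
  simpa only [mul_assoc] using congrArg (· * x) (gen_braid h)

theorem mk_of_mul (i : ι) (w : FreeMonoid ι) : mk (Rel G) (.of i * w) = gen i * mk (Rel G) w :=
  rfl

theorem eq_or_compl_adj_or_adj (G : SimpleGraph ι) (i j : ι) :
    i = j ∨ Gᶜ.Adj i j ∨ G.Adj i j := by
  rw [SimpleGraph.compl_adj]
  tauto

/-- The word length, written multiplicatively. -/
def lengthHom (G : SimpleGraph ι) : ArtinMonoid G →* Multiplicative ℕ :=
  PresentedMonoid.lift (fun _ ↦ Multiplicative.ofAdd 1) (by rintro _ _ (h | h) <;> rfl)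

/-- The number of letters of any word that represents the element. -/
def length (x : ArtinMonoid G) : ℕ := (lengthHom G x).toAdd

@[simp] theorem length_one : length (1 : ArtinMonoid G) = 0 := by simp [length]

@[simp] theorem length_gen (i : ι) : length (gen i : ArtinMonoid G) = 1 := rfl

@[simp] theorem length_mul (x y : ArtinMonoid G) : length (x * y) = length x + length y := by
  simp [length]

theorem length_eq_of_gen_mul_eq {x y : ArtinMonoid G} (h : gen i * x = gen j * y) :
    length x = length y := by
  simpa using congrArg length h

theorem eq_one_or_exists_eq_gen_mul (x : ArtinMonoid G) : x = 1 ∨ ∃ i y, x = gen i * y := by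
  obtain ⟨w, rfl⟩ := surjective_mk x
  cases w with
  | one => exact .inl rfl
  | of_mul i w => exact .inr ⟨i, _, mk_of_mul i w⟩

/-- `LcmMultiple i j x y` says that `gen i * x` and `gen j * y` are equal because both are the same
multiple of the least common right multiple of `gen i` and `gen j`. -/
inductive LcmMultiple : ι → ι → ArtinMonoid G → ArtinMonoid G → Prop
  | refl (i : ι) (x : ArtinMonoid G) : LcmMultiple i i x x
  | commute {i j : ι} (h : Gᶜ.Adj i j) (w : ArtinMonoid G) :
      LcmMultiple i j (gen j * w) (gen i * w)
  | braid {i j : ι} (h : G.Adj i j) (w : ArtinMonoid G) :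
      LcmMultiple i j (gen j * (gen i * w)) (gen i * (gen j * w))

namespace LcmMultiple

variable {x y : ArtinMonoid G}

theorem symm (h : LcmMultiple i j x y) : LcmMultiple j i y x := by
  cases h with
  | refl => exact .refl _ _
  | commute h w => exact .commute h.symm w
  | braid h w => exact .braid h.symm w

theorem mul_right (h : LcmMultiple i j x y) (u : ArtinMonoid G) :
    LcmMultiple i j (x * u) (y * u) := by
  cases h with
  | refl => exact .refl _ _
  | commute h w => simpa only [mul_assoc] using commute h (w * u)
  | braid h w => simpa only [mul_assoc] using braid h (w * u)

theorem gen_mul_left (h : LcmMultiple i j x y) {g : ι} (hi : Gᶜ.Adj g i) (hj : Gᶜ.Adj g j) :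
    LcmMultiple i j (gen g * x) (gen g * y) := by
  cases h with
  | refl => exact .refl _ _
  | commute h w => simpa only [gen_left_comm hi, gen_left_comm hj] using commute h (gen g * w)
  | braid h w => simpa only [gen_left_comm hi, gen_left_comm hj] using braid h (gen g * w)

theorem eq (h : LcmMultiple i i x y) : x = y := by
  cases h with
  | refl => rfl
  | commute h => exact absurd rfl h.ne
  | braid h => exact absurd rfl h.ne

theorem of_compl_adj (h : LcmMultiple i j x y) (hij : Gᶜ.Adj i j) :
    ∃ w, x = gen j * w ∧ y = gen i * w := by
  cases h with
  | refl => exact absurd rfl hij.ne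
  | commute _ w => exact ⟨w, rfl, rfl⟩
  | braid h => exact absurd h (G.compl_adj i j |>.1 hij).2

theorem of_adj (h : LcmMultiple i j x y) (hij : G.Adj i j) :
    ∃ w, x = gen j * (gen i * w) ∧ y = gen i * (gen j * w) := by
  cases h with
  | refl => exact absurd rfl hij.ne
  | commute h => exact absurd hij (G.compl_adj i j |>.1 h).2
  | braid _ w => exact ⟨w, rfl, rfl⟩

end LcmMultiple

/-- Garside's lemma for common multiples of length at most `N`; it is the induction hypothesis in
the proof of the lemma itself. -/
def GarsideBelow (G : SimpleGraph ι) (N : ℕ) : Prop :=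
  ∀ ⦃i j : ι⦄ ⦃x y : ArtinMonoid G⦄, length x < N → gen i * x = gen j * y → LcmMultiple i j x y

namespace GarsideBelow

variable {N : ℕ} {a b g : ι} {x y w X Y : ArtinMonoid G}

theorem gen_mul_ne_of_triangle (ih : GarsideBelow G N) (hga : G.Adj g a) (hgb : G.Adj g b)
    (hab : G.Adj a b) (hN : length X < N) : gen g * X ≠ gen b * (gen a * Y) := by
  intro h
  induction hn : length X using Nat.strong_induction_on generalizing g a b X Y with
  | _ n descent =>
    -- Cycling the triangle turns the equation `h` into one with the shorter `T` in place of `X`.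
    obtain ⟨T, rfl, hT⟩ := (ih hN h).of_adj hgb
    simp only [length_mul, length_gen] at hN hn
    have hl := length_eq_of_gen_mul_eq hT
    simp only [length_mul, length_gen] at hl
    exact descent _ (by omega) hab hga.symm hgb.symm (by omega) hT rfl

theorem trans_commute_braid (ih : GarsideBelow G N) (hag : Gᶜ.Adj a g) (hgb : G.Adj g b)
    (hN : length X < N) (hX : gen a * X = gen b * (gen g * Y)) :
    LcmMultiple a b (gen g * X) (gen g * (gen b * Y)) := by
  have hl := length_eq_of_gen_mul_eq hX
  have hlcm := ih hN hX
  rcases eq_or_compl_adj_or_adj G a b with rfl | hab | hab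
  · exact absurd hgb.symm (G.compl_adj a g |>.1 hag).2
  · obtain ⟨Z, rfl, hZ⟩ := hlcm.of_compl_adj hab
    simp only [length_mul, length_gen] at hl hN
    obtain ⟨T, rfl, rfl⟩ := (ih (by omega) hZ).of_compl_adj hag.symm
    convert LcmMultiple.commute hab (gen g * (gen b * T)) using 1
    · exact gen_left_braid hgb T
    · rw [← gen_left_comm hab, ← gen_left_comm hag]
  · obtain ⟨Z, rfl, hZ⟩ := hlcm.of_adj hab
    simp only [length_mul, length_gen] at hl hN
    obtain ⟨T, rfl, hT⟩ := (ih (by omega) hZ).of_compl_adj hag.symm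
    obtain ⟨R, rfl, rfl⟩ := (ih (by omega) hT).of_adj hgb.symm
    convert LcmMultiple.braid hab (gen g * (gen b * (gen a * R))) using 1
    · rw [gen_left_comm hag, gen_left_braid hgb, ← gen_left_braid hab, gen_left_comm hag.symm]
    · rw [← gen_left_braid hgb, gen_left_braid hab.symm, gen_left_comm hag.symm (gen b * _),
        gen_left_comm hag.symm R]

theorem trans_braid_braid (ih : GarsideBelow G N) (hag : G.Adj a g) (hgb : G.Adj g b)
    (hN : length X + 1 < N) (hX : gen a * (gen g * X) = gen b * (gen g * Y)) :
    LcmMultiple a b (gen g * (gen a * X)) (gen g * (gen b * Y)) := by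
  have hl := length_eq_of_gen_mul_eq hX
  simp only [length_mul, length_gen] at hl
  have hlcm := ih (by simp only [length_mul, length_gen]; omega) hX
  rcases eq_or_compl_adj_or_adj G a b with rfl | hab | hab
  · have hXY : X = Y := (ih (by omega) hlcm.eq).eq
    exact hXY ▸ .refl _ _
  · obtain ⟨Z, hXZ, hYZ⟩ := hlcm.of_compl_adj hab
    have hYN : length Y < N := by omega
    obtain ⟨T, rfl, rfl⟩ := (ih (by omega) hXZ).of_adj hgb
    obtain ⟨S, rfl, hTS⟩ := (ih hYN hYZ).of_adj hag.symm
    simp only [length_mul, length_gen] at hN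
    have hTS' : gen b * T = gen a * S :=
      (ih (by simp only [length_mul, length_gen]; omega) hTS).eq
    obtain ⟨R, rfl, rfl⟩ := (ih (by omega) hTS').of_compl_adj hab.symm
    convert LcmMultiple.commute hab (gen g * (gen b * (gen a * (gen g * R)))) using 1
    · rw [gen_left_comm hab, gen_left_braid hag, gen_left_braid hgb]
    · rw [gen_left_comm hab.symm, ← gen_left_braid hgb, gen_left_braid hag.symm, gen_left_comm hab]
  · obtain ⟨Z, hXZ, -⟩ := hlcm.of_adj hab
    exact absurd hXZ (ih.gen_mul_ne_of_triangle hag.symm hgb hab (by omega))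

theorem trans (ih : GarsideBelow G N) (hN : length w ≤ N) (h₁ : LcmMultiple a g x w)
    (h₂ : LcmMultiple g b w y) : LcmMultiple a b x y := by
  generalize hw : w = w' at h₂
  have hN' : length w' ≤ N := hw ▸ hN
  cases h₁ with
  | refl => exact hw ▸ h₂
  | commute hag X =>
    simp only [length_mul, length_gen] at hN
    cases h₂ with
    | refl => exact hw ▸ .commute hag X
    | commute hgb Y => exact (ih (by omega) hw).gen_mul_left hag.symm hgb
    | braid hgb Y => exact ih.trans_commute_braid hag hgb (by omega) hw
  | braid hag X =>
    simp only [length_mul, length_gen] at hN hN'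
    cases h₂ with
    | refl => exact hw ▸ .braid hag X
    | commute hgb Y =>
      simp only [length_mul, length_gen] at hN'
      exact (ih.trans_commute_braid hgb.symm hag.symm (by omega) hw.symm).symm
    | braid hgb Y => exact ih.trans_braid_braid hag hgb (by omega) hw

end GarsideBelow

section Words

variable {w w' u v : FreeMonoid ι}

theorem length_mk (w : FreeMonoid ι) : length (mk (Rel G) w) = w.length := by
  induction w with
  | one => simp
  | of i => rfl
  | mul x y hx hy => simp [hx, hy]

theorem length_eq_of_rel (h : ConGen.Rel (Rel G) w w') : w.length = w'.length := by
  rw [← length_mk (G := G), ← length_mk (G := G), mk_eq_mk_iff.2 h]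

theorem of_mul_eq_of_mul (h : FreeMonoid.of i * u = .of j * v) : i = j ∧ u = v :=
  List.cons.inj h

theorem exists_eq_of_mul_of_rel (h : ConGen.Rel (Rel G) (.of i * u) w) :
    ∃ j v, w = .of j * v := by
  cases w with
  | one => simpa using length_eq_of_rel h
  | of_mul j v => exact ⟨j, v, rfl⟩

theorem GarsideBelow.lcmMultiple_of_rel {N : ℕ} (ih : GarsideBelow G N)
    (h : ConGen.Rel (Rel G) w w') (hN : w.length ≤ N + 1) (hw : w = .of i * u)
    (hw' : w' = .of j * v) : LcmMultiple i j (mk (Rel G) u) (mk (Rel G) v) := by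
  induction h generalizing i j u v with
  | of _ _ h =>
    cases h with
    | commute h =>
      obtain ⟨rfl, rfl⟩ := of_mul_eq_of_mul hw
      obtain ⟨rfl, rfl⟩ := of_mul_eq_of_mul hw'
      simpa [gen, PresentedMonoid.of] using LcmMultiple.commute h 1
    | braid h =>
      obtain ⟨rfl, rfl⟩ := of_mul_eq_of_mul hw
      obtain ⟨rfl, rfl⟩ := of_mul_eq_of_mul hw'
      simpa [gen, PresentedMonoid.of] using LcmMultiple.braid h 1
  | refl =>
    obtain ⟨rfl, rfl⟩ := of_mul_eq_of_mul (hw.symm.trans hw')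
    exact .refl _ _
  | symm h ih' => exact (ih' (length_eq_of_rel h ▸ hN) hw' hw).symm
  | trans h₁ h₂ ih₁ ih₂ =>
    have hl := length_eq_of_rel h₁
    subst hw
    obtain ⟨g, t, rfl⟩ := exists_eq_of_mul_of_rel h₁
    refine ih.trans ?_ (ih₁ hN rfl rfl) (ih₂ (hl ▸ hN) rfl hw')
    simp only [FreeMonoid.length_mul, FreeMonoid.length_of] at hl hN
    rw [length_mk]
    omega
  | @mul w₁ w₁' w₂ w₂' h₁ h₂ ih₁ ih₂ =>
    rw [FreeMonoid.length_mul] at hN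
    cases w₁ with
    | one =>
      obtain rfl : w₁' = 1 := FreeMonoid.length_eq_zero.1 (length_eq_of_rel h₁).symm
      rw [one_mul] at hw hw'
      exact ih₂ (by omega) hw hw'
    | of_mul a s =>
      obtain ⟨b, t, rfl⟩ := exists_eq_of_mul_of_rel h₁
      rw [mul_assoc] at hw hw'
      obtain ⟨rfl, rfl⟩ := of_mul_eq_of_mul hw
      obtain ⟨rfl, rfl⟩ := of_mul_eq_of_mul hw'
      rw [map_mul, map_mul, mk_eq_mk_iff.2 h₂]
      exact (ih₁ (by omega) rfl rfl).mul_right _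

theorem lcmMultiple_of_gen_mul_eq {x y : ArtinMonoid G} (h : gen i * x = gen j * y) :
    LcmMultiple i j x y := by
  suffices garside : ∀ N, GarsideBelow G N from garside _ (Nat.lt_succ_self _) h
  intro N
  induction N with
  | zero => intro _ _ _ _ h; omega
  | succ N ih =>
    intro i j x y hN h
    obtain ⟨u, rfl⟩ := surjective_mk x
    obtain ⟨v, rfl⟩ := surjective_mk y
    rw [← mk_of_mul, ← mk_of_mul] at h
    refine ih.lcmMultiple_of_rel (mk_eq_mk_iff.1 h) ?_ rfl rfl
    rw [length_mk] at hN
    rw [FreeMonoid.length_mul, FreeMonoid.length_of]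
    omega

end Words

instance : IsLeftCancelMul (ArtinMonoid G) where
  mul_left_cancel x := by
    have hx : x ∈ Submonoid.closure (Set.range (PresentedMonoid.of (Rel G))) := by simp
    induction hx using Submonoid.closure_induction with
    | mem _ hi =>
      obtain ⟨i, rfl⟩ := hi
      exact fun _ _ h ↦ (lcmMultiple_of_gen_mul_eq h).eq
    | one => exact isRegular_one.left
    | mul x y _ _ hx hy => exact IsLeftRegular.mul hx hy

section Powers

variable {m : ℕ} {x y : ArtinMonoid G}

theorem gen_dvd_of_gen_pow_mul_eq (hij : Gᶜ.Adj i j) (h : gen i ^ m * x = gen j * y) :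
    gen j ∣ x := by
  induction m generalizing y with
  | zero => exact ⟨y, by simpa only [pow_zero, one_mul] using h⟩
  | succ m ih =>
    rw [pow_succ', mul_assoc] at h
    obtain ⟨w, hw, -⟩ := (lcmMultiple_of_gen_mul_eq h).of_compl_adj hij
    exact ih hw

theorem gen_mul_gen_dvd_of_gen_pow_mul_eq (hij : G.Adj i j) (hm : m ≠ 0)
    (h : gen i ^ m * x = gen j * y) : gen j * gen i ∣ x := by
  induction m generalizing y with
  | zero => exact absurd rfl hm
  | succ m ih =>
    rw [pow_succ', mul_assoc] at h
    obtain ⟨w, hw, -⟩ := (lcmMultiple_of_gen_mul_eq h).of_adj hij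
    obtain rfl | hm := eq_or_ne m 0
    · exact ⟨w, by simpa only [pow_zero, one_mul, mul_assoc] using hw⟩
    · exact ih hm hw

theorem not_gen_dvd_one (i : ι) : ¬ gen i ∣ (1 : ArtinMonoid G) := by
  rintro ⟨x, hx⟩
  have := congrArg length hx
  simp only [length_one, length_mul, length_gen] at this
  omega

theorem eq_of_gen_pow_eq (hm : m ≠ 0) (h : (gen i ^ m : ArtinMonoid G) = gen j ^ m) : i = j := by
  have hdvd : gen i ^ m * 1 = (gen j * gen j ^ (m - 1) : ArtinMonoid G) := by
    rw [mul_one, h, mul_pow_sub_one hm]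
  rcases eq_or_compl_adj_or_adj G i j with hij | hij | hij
  · exact hij
  · exact absurd (gen_dvd_of_gen_pow_mul_eq hij hdvd) (not_gen_dvd_one j)
  · exact absurd ((dvd_mul_right _ _).trans (gen_mul_gen_dvd_of_gen_pow_mul_eq hij hm hdvd))
      (not_gen_dvd_one j)

theorem gen_mul_gen_semiconjBy (hij : G.Adj i j) :
    SemiconjBy (gen j * gen i : ArtinMonoid G) (gen j) (gen i) := by
  simpa only [SemiconjBy, mul_assoc] using gen_braid hij.symm

theorem gen_semiconjBy_of_pow (hm : m ≠ 0) (h : SemiconjBy x (gen j ^ m) (gen i ^ m)) :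
    SemiconjBy x (gen j) (gen i) := by
  induction hn : length x using Nat.strong_induction_on generalizing x i with
  | _ n ih =>
    obtain rfl | ⟨c, y, rfl⟩ := eq_one_or_exists_eq_gen_mul x
    · obtain rfl : j = i :=
        eq_of_gen_pow_eq hm (by simpa only [SemiconjBy, one_mul, mul_one] using h)
      exact .one_left _
    have of_left_factor {u w : ArtinMonoid G} {c : ι} (hu : SemiconjBy u (gen c) (gen i))
        (h : SemiconjBy (u * w) (gen j ^ m) (gen i ^ m)) (hw : length w < n) :
        SemiconjBy (u * w) (gen j) (gen i) := by
      refine hu.mul_left (ih _ hw (mul_left_cancel (a := u) ?_) rfl)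
      rw [← mul_assoc, h.eq, ← mul_assoc, ← mul_assoc, (hu.pow_right m).eq]
    simp only [length_mul, length_gen] at hn
    have hdvd : gen i ^ m * (gen c * y) = gen c * (y * gen j ^ m) := by rw [← h.eq, mul_assoc]
    rcases eq_or_compl_adj_or_adj G i c with rfl | hic | hic
    · exact of_left_factor (Commute.refl _) h (by omega)
    · exact of_left_factor (gen_commute hic).symm h (by omega)
    · obtain ⟨w, hw⟩ := gen_mul_gen_dvd_of_gen_pow_mul_eq hic hm hdvd
      have hwn : length w < n := by
        have := congrArg length hw
        simp only [length_mul, length_gen] at this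
        omega
      rw [hw] at h ⊢
      exact of_left_factor (gen_mul_gen_semiconjBy hic) h hwn

theorem commute_gen_of_commute_gen_pow (hm : m ≠ 0) (h : Commute (gen i ^ m) x) :
    Commute (gen i) x :=
  (gen_semiconjBy_of_pow hm h.symm).symm

end Powers

section PathGraph

open SimpleGraph (pathGraph pathGraph_adj)

variable {k : ℕ}

theorem compl_pathGraph_adj {i j : Fin k} :
    (pathGraph k)ᶜ.Adj i j ↔ (i : ℕ) + 2 ≤ j ∨ (j : ℕ) + 2 ≤ i := by
  rw [SimpleGraph.compl_adj, pathGraph_adj, ne_eq, Fin.ext_iff]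
  omega

theorem isBraidFamily_gen : IsBraidFamily (gen : Fin k → ArtinMonoid (pathGraph k)) where
  commute h := gen_commute (compl_pathGraph_adj.2 (.inl h))
  braid h := by
    rw [mul_assoc, mul_assoc]
    exact gen_braid (pathGraph_adj.2 (.inl h))

theorem isCentralCofinal_fullTwist :
    IsCentralCofinal (fullTwist (gen : Fin k → ArtinMonoid (pathGraph k))) := by
  refine .of_closure_eq_top (PresentedMonoid.closure_range_of _) ?_ ?_ <;> rintro _ ⟨i, rfl⟩
  · exact isBraidFamily_gen.commute_fullTwist i
  · exact isBraidFamily_gen.dvd_fullTwist i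

end PathGraph

end ArtinMonoid

section BraidGroup

open ArtinMonoid

variable {n k : ℕ}

theorem isBraidFamily_braidGen (n : ℕ) : IsBraidFamily (braidGen n) where
  commute h := mul_inv_eq_one.1 (PresentedGroup.one_of_mem (.inl ⟨_, _, h, rfl⟩))
  braid h := mul_inv_eq_one.1 (PresentedGroup.one_of_mem (.inr ⟨_, _, h, rfl⟩))

/-- The universal property of the braid group. -/
def IsBraidFamily.lift {H : Type*} [Group H] {f : Fin (n - 1) → H} (hf : IsBraidFamily f) :
    BraidGroup n →* H :=
  PresentedGroup.toGroup (f := f) <| by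
    rintro _ (⟨i, j, h, rfl⟩ | ⟨i, j, h, rfl⟩)
    · simpa only [map_mul, map_inv, FreeGroup.lift_apply_of, mul_inv_eq_one] using (hf.commute h).eq
    · simpa only [map_mul, map_inv, FreeGroup.lift_apply_of, mul_inv_eq_one] using hf.braid h

theorem IsBraidFamily.lift_braidGen {H : Type*} [Group H] {f : Fin (n - 1) → H}
    (hf : IsBraidFamily f) (i : Fin (n - 1)) : hf.lift (braidGen n i) = f i :=
  PresentedGroup.toGroup.of _

/-- The canonical map from positive braids to braids. -/
def positiveBraidHom (n : ℕ) : ArtinMonoid (SimpleGraph.pathGraph (n - 1)) →* BraidGroup n :=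
  PresentedMonoid.lift (braidGen n) <| by
    have hf := isBraidFamily_braidGen n
    rintro _ _ (@⟨i, j, h⟩ | @⟨i, j, h⟩)
    · obtain h | h := compl_pathGraph_adj.1 h
      · simpa using (hf.commute h).eq
      · simpa using (hf.commute h).symm.eq
    · obtain h | h := SimpleGraph.pathGraph_adj.1 h
      · simpa [mul_assoc] using hf.braid h
      · simpa [mul_assoc] using (hf.braid h).symm

theorem positiveBraidHom_gen (i : Fin (n - 1)) : positiveBraidHom n (gen i) = braidGen n i :=
  rfl

theorem closure_range_positiveBraidHom (n : ℕ) :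
    Subgroup.closure (Set.range (positiveBraidHom n)) = ⊤ := by
  rw [eq_top_iff, ← PresentedGroup.closure_range_of (braidRels n)]
  refine Subgroup.closure_mono ?_
  rintro _ ⟨i, rfl⟩
  exact ⟨gen i, rfl⟩

theorem positiveBraidHom_injective (n : ℕ) : Function.Injective (positiveBraidHom n) := by
  obtain ⟨H, _, f, hf⟩ := isCentralCofinal_fullTwist (k := n - 1).exists_injective_monoidHom_group
  have hgen := isBraidFamily_gen.map f
  have hfactor : hgen.lift.comp (positiveBraidHom n) = f := by
    ext i
    exact hgen.lift_braidGen i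
  rw [← hfactor, MonoidHom.coe_comp] at hf
  exact hf.of_comp

theorem commute_braidGen_of_commute_braidGen_pow {m : ℕ} (hm : m ≠ 0) {i : Fin (n - 1)}
    {q : BraidGroup n} (h : Commute (braidGen n i ^ m) q) : Commute (braidGen n i) q := by
  rw [← positiveBraidHom_gen, ← map_pow] at h
  exact isCentralCofinal_fullTwist.commute_map_of_forall_commute
    (closure_range_positiveBraidHom n) (positiveBraidHom_injective n)
    (fun _ ↦ commute_gen_of_commute_gen_pow hm) h

theorem halfTwist_eq_of_pow_eq {hn : 2 ≤ n} {H₁ H₂ : BraidGroup n} (h₁ : H₁ ∈ halfTwists n hn)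
    (h₂ : H₂ ∈ halfTwists n hn) {m : ℕ} (hm : m ≠ 0) (h : H₁ ^ m = H₂ ^ m) : H₁ = H₂ := by
  obtain ⟨q₁, rfl⟩ := h₁
  obtain ⟨q₂, rfl⟩ := h₂
  exact conj_eq_conj_of_pow_eq (fun _ ↦ commute_braidGen_of_commute_braidGen_pow hm) h

theorem isBraidFamily_swap :
    IsBraidFamily fun i : Fin k ↦ Equiv.swap i.castSucc i.succ where
  commute h := by
    refine (Equiv.Perm.disjoint_swap_swap ?_).commute
    simp only [List.nodup_cons, List.mem_cons, Fin.ext_iff, Fin.val_castSucc, Fin.val_succ,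
      List.not_mem_nil, or_false, not_false_eq_true, List.nodup_nil, and_true]
    omega
  braid {i j} h := by
    have hij : j.castSucc = i.succ := (Fin.ext h).symm
    have hlt : i.succ < j.succ := hij ▸ j.castSucc_lt_succ
    have hij' : i.castSucc < i.succ := i.castSucc_lt_succ
    rw [hij, Equiv.swap_mul_swap_mul_swap hij'.ne (hij'.trans hlt).ne,
      Equiv.swap_comm i.castSucc, Equiv.swap_comm i.succ j.succ,
      Equiv.swap_mul_swap_mul_swap hlt.ne' (hij'.trans hlt).ne', Equiv.swap_comm]

theorem exists_sq_eq_sq_and_ne : ∃ a b : BraidGroup 4, a ^ 2 = b ^ 2 ∧ a ≠ b := by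
  let c : BraidGroup 4 := coxeterProd (braidGen 4)
  let s : BraidGroup 4 := braidGen 4 0
  have hcentral : Commute (c ^ 4) s := (isBraidFamily_braidGen 4).commute_fullTwist 0
  refine ⟨c ^ 2, s * c ^ 2 * s⁻¹, ?_, fun h ↦ ?_⟩
  · rw [conj_pow, ← pow_mul, ← hcentral.eq, mul_inv_cancel_right]
  · let σ (i : Fin 3) : Equiv.Perm (Fin 4) := Equiv.swap i.castSucc i.succ
    have hσ : IsBraidFamily σ := isBraidFamily_swap
    let π : BraidGroup 4 →* Equiv.Perm (Fin 4) := IsBraidFamily.lift hσ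
    have hs : π s = σ 0 := IsBraidFamily.lift_braidGen hσ 0
    have hc : π c = coxeterProd σ :=
      (map_coxeterProd π _).trans (congrArg coxeterProd (funext hσ.lift_braidGen))
    have hne : coxeterProd σ ^ 2 ≠ σ 0 * coxeterProd σ ^ 2 * (σ 0)⁻¹ := by decide
    exact hne (by simpa only [map_mul, map_pow, map_inv, hs, hc] using congrArg π h)

end BraidGroup

theorem theorem2p11 :
    (∀ (n : ℕ) (hn : 2 ≤ n) (H₁ H₂ : BraidGroup n),
      H₁ ∈ halfTwists n hn → H₂ ∈ halfTwists n hn →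
        ∀ m : ℕ, 1 ≤ m → H₁ ^ m = H₂ ^ m → H₁ = H₂) ∧
    (∃ a b : BraidGroup 4, a ^ 2 = b ^ 2 ∧ a ≠ b) :=
  ⟨fun _ _ _ _ h₁ h₂ _ hm h ↦ halfTwist_eq_of_pow_eq h₁ h₂ (Nat.one_le_iff_ne_zero.1 hm) h,
    exists_sq_eq_sq_and_ne⟩
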